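/- Let $W_e$ denote the $e$-th computably enumerable set of natural numbers. For equivalence relations $E,F$ on $\mathbb N$, write $E\leq_c F$ if there is a computable $f:\mathbb N\to\mathbb N$ such that $x\,E\,y\iff f(x)\,F\,f(y)$ for all $x,y\in\mathbb N$. For $n\ge 1$, let $h$ be any computable bijective encoding into $\mathbb N$ of the ordinals below $\omega^n$, each given by its Cantor normal form $\omega^{e_1}c_1+\dots+\omega^{e_k}c_k$ with $e_1>\dots>e_k$ natural numbers and $c_1,\dots,c_k$ positive integers, and order $\mathbb N$ by $a\leq_{\mathcal A} b\iff h^{-1}(a)\leq h^{-1}(b)$. The relation $E_{\min}(\omega^n)$ on $\mathbb N$ is defined by: $e\;E_{\min}(\omega^n)\;i$ if and only if $W_e$ and $W_i$ have the same $\leq_{\mathcal A}$-least element or are both empty. Let $\mathcal{CS}_n[e]=\langle x_0,\dots,x_{n-1}\mid W_e\rangle_{\mathcal{CS}}$ be the commutative semigroup presented by the generators $x_0,\dots,x_{n-1}$ and the identities encoded by the elements of $W_e$ (under a fixed computable bijective encoding of pairs of terms over these generators by natural numbers); that is, the quotient of the term algebra over $x_0,\dots,x_{n-1}$ by the congruence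 generated by these identities and all instances of associativity and commutativity. Let $e\cong_{\mathcal{CS}_n} i$ mean that $\mathcal{CS}_n[e]$ and $\mathcal{CS}_n[i]$ are isomorphic. **Theorem.** For every $n\geq 2$ (and every encoding $h$ as above), $E_{\min}(\omega^n)\leq_c\ {\cong_{\mathcal{CS}_n}}$. -/

import Mathlib

/-- The `e`-th computably enumerable set `W_e`: the domain of the partial computable function
whose program has Gödel number `e`. -/
def W (e : ℕ) : Set ℕ :=
  {x | ((Denumerable.ofNat Nat.Partrec.Code e).eval x).Dom}

/-- Computable reducibility `E ≤_c F` of equivalence relations on `ℕ`. -/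
def ComputablyReducible (E F : ℕ → ℕ → Prop) : Prop :=
  ∃ f : ℕ → ℕ, Computable f ∧ ∀ x y, E x y ↔ F (f x) (f y)

/-! ### The benchmark relations `E_min(α)`, for `α ≤ ω ^ ω` -/

/-- `m` is a least element of `S` with respect to `le`. -/
def IsLeastIn (le : ℕ → ℕ → Prop) (S : Set ℕ) (m : ℕ) : Prop :=
  m ∈ S ∧ ∀ x ∈ S, le m x

/-- `E_min(𝒜)` for an ordering `𝒜 = (ℕ, le)`: two indices are related if their c.e. sets have the
same `𝒜`-least element or are both empty. -/
def EMin (le : ℕ → ℕ → Prop) (e i : ℕ) : Prop :=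
  (∃ m, IsLeastIn le (W e) m ∧ IsLeastIn le (W i) m) ∨ (W e = ∅ ∧ W i = ∅)

/-- The list `[(e₁, c₁), …, (e_k, c_k)]` is in Cantor normal form: `e₁ > ⋯ > e_k` and all
coefficients are positive. -/
def IsNormalForm (l : List (ℕ × ℕ)) : Prop :=
  l.Pairwise (fun p q => q.1 < p.1) ∧ ∀ p ∈ l, 0 < p.2

/-- The ordinal `ω ^ e₁ * c₁ + ⋯ + ω ^ e_k * c_k` denoted by the list
`[(e₁, c₁), …, (e_k, c_k)]`. -/
noncomputable def ordValue (l : List (ℕ × ℕ)) : Ordinal.{0} :=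
  (l.map fun p => Ordinal.omega0 ^ p.1 * (p.2 : Ordinal.{0})).sum

/-- The Cantor normal forms of the ordinals below `α` (for `α ≤ ω ^ ω`). -/
def normalFormsBelow (α : Ordinal.{0}) : Set (List (ℕ × ℕ)) :=
  {l | IsNormalForm l ∧ ordValue l < α}

/-- `h` is a bijective computable encoding into `ℕ` of the ordinals below `α`, given by their
Cantor normal forms (the values of `h` outside of these normal forms are irrelevant). -/
structure IsOrdinalEncoding (α : Ordinal.{0}) (h : List (ℕ × ℕ) → ℕ) : Prop where
  computable : Computable h
  bijOn : Set.BijOn h (normalFormsBelow α) Set.univ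

/-- The ordering `𝒜_α` of `ℕ` induced by the encoding `h` of the ordinals below `α`. -/
def encodedLE (α : Ordinal.{0}) (h : List (ℕ × ℕ) → ℕ) (a b : ℕ) : Prop :=
  ∃ s ∈ normalFormsBelow α, ∃ t ∈ normalFormsBelow α,
    h s = a ∧ h t = b ∧ ordValue s ≤ ordValue t

/-! ### Isomorphism of `n`-generated c.e. commutative semigroups -/

/-- Terms over the generators `x_0, …, x_{n-1}` in the signature with one binary function symbol
(multiplication). -/
abbrev CSTerm (n : ℕ) : Type := FreeMagma (Fin n)

/-- The encoding of terms: `x_i ↦ i` and `s * t ↦ n + ⟨code s, code t⟩`. -/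
def termCode {n : ℕ} : CSTerm n → ℕ
  | .of i => i
  | .mul s t => n + Nat.pair (termCode s) (termCode t)

/-- The encoding of identities (pairs of terms). -/
def identityCode {n : ℕ} (p : CSTerm n × CSTerm n) : ℕ :=
  Nat.pair (termCode p.1) (termCode p.2)

/-- The identities of the presentation `⟨x_0, …, x_{n-1} | W_e⟩` in the variety of commutative
semigroups: those encoded by the elements of `W_e`, and all instances of the two laws. -/
inductive CSIdentity (n e : ℕ) : CSTerm n → CSTerm n → Prop
  | rel (s t : CSTerm n) : identityCode (s, t) ∈ W e → CSIdentity n e s t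
  | assoc (s t u : CSTerm n) : CSIdentity n e (s * t * u) (s * (t * u))
  | comm (s t : CSTerm n) : CSIdentity n e (s * t) (t * s)

/-- The commutative semigroup presented by `⟨x_0, …, x_{n-1} | W_e⟩`: the quotient of the term
algebra by the smallest congruence containing these identities. -/
abbrev CS (n e : ℕ) : Type := (conGen (CSIdentity n e)).Quotient

/-- The isomorphism relation of `n`-generated c.e. commutative semigroups. -/
def CSIso (n e i : ℕ) : Prop := Nonempty (CS n e ≃* CS n i)

/-- The encoding of identities is bijective. -/
theorem identityCode_bijective {n : ℕ} (hn : 1 ≤ n) :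
    Function.Bijective (identityCode (n := n)) := by
  have inj : ∀ s t : CSTerm n, termCode s = termCode t → s = t := by
    intro s
    induction s with
    | of i =>
      intro t h
      cases t with
      | of j => exact congrArg FreeMagma.of (Fin.ext h)
      | mul a b =>
        have := i.2
        change (i : ℕ) = n + _ at h
        omega
    | mul a b iha ihb =>
      intro t h
      cases t with
      | of j =>
        have := j.2
        change n + _ = (j : ℕ) at h
        omega
      | mul c d =>
        have h' : Nat.pair (termCode a) (termCode b) = Nat.pair (termCode c) (termCode d) :=
          Nat.add_left_cancel (h : n + _ = n + _)
        rw [Nat.pair_eq_pair] at h'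
        rw [iha c h'.1, ihb d h'.2]
  have surj : ∀ m : ℕ, ∃ s : CSTerm n, termCode s = m := by
    intro m
    induction m using Nat.strong_induction_on with
    | _ m ih =>
      by_cases hm : m < n
      · exact ⟨.of ⟨m, hm⟩, rfl⟩
      · have h1 := Nat.unpair_left_le (m - n)
        have h2 := Nat.unpair_right_le (m - n)
        obtain ⟨s, hs⟩ := ih (m - n).unpair.1 (by omega)
        obtain ⟨t, ht⟩ := ih (m - n).unpair.2 (by omega)
        refine ⟨.mul s t, ?_⟩
        change n + Nat.pair (termCode s) (termCode t) = m
        rw [hs, ht, Nat.pair_unpair]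
        omega
  constructor
  · rintro ⟨s, t⟩ ⟨s', t'⟩ h
    have h' := Nat.pair_eq_pair.1 (h : Nat.pair _ _ = Nat.pair _ _)
    exact Prod.ext (inj _ _ h'.1) (inj _ _ h'.2)
  · intro m
    obtain ⟨s, hs⟩ := surj m.unpair.1
    obtain ⟨t, ht⟩ := surj m.unpair.2
    exact ⟨(s, t), by simp [identityCode, hs, ht]⟩

/-! Read the exponents of a monomial in `x_0, …, x_{n-1}` as the coefficients of an ordinal below `ω
^ n`, with `x_i` counting for `ω ^ i`. Multiplication never lowers this ordinal, so for each `μ` the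
terms of ordinal greater than `μ` form an ideal `I_μ` of the free commutative semigroup. The
reduction equates any two terms whose ordinals both exceed ordinals coded in `W e`
(`exists_collapses`). The quotient collapses `I_μ` to a zero, where `μ` is the least ordinal coded
in `W e`; it is free if `W e` is empty.

The ideal determines `μ` (`IsOrdinalEncoding.eMin_iff`): if `μ < ν`, a term of ordinal `ν` lies in
`I_μ` but not in `I_ν`. The strict inequality matters: no term has ordinal `0`, so with `≥` the
minima `0` and `1` would both give the ideal of all terms.

An isomorphism of quotients preserves the zero and permutes the surviving generators, as these are
not products. Hence some permutation `σ` of the generators carries one ideal onto the other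
(`Collapses.exists_perm`). The ideals in question form a chain (`InIdeal.total`), and iterating `σ`
up to its order turns the inclusion into equality (`Collapses.eq_of_le`). -/

/-! ### Ordinals below `ω ^ k` as sequences of coefficients -/

/-- The ordinal `ω ^ (k - 1) * u (k - 1) + ⋯ + ω ^ 0 * u 0`. -/
noncomputable def coeffValue (u : ℕ → ℕ) : ℕ → Ordinal.{0}
  | 0 => 0
  | k + 1 => Ordinal.omega0 ^ k * (u k : Ordinal.{0}) + coeffValue u k

/-- The Cantor normal form of `coeffValue u k`. -/
def coeffNormalForm (u : ℕ → ℕ) : ℕ → List (ℕ × ℕ)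
  | 0 => []
  | k + 1 => if u k = 0 then coeffNormalForm u k else (k, u k) :: coeffNormalForm u k

/-- The lexicographic comparison of `coeffValue u k` and `coeffValue w k`. -/
def CoeffLT (u w : ℕ → ℕ) : ℕ → Prop
  | 0 => False
  | k + 1 => u k < w k ∨ u k = w k ∧ CoeffLT u w k

theorem coeffValue_lt (u : ℕ → ℕ) (k : ℕ) : coeffValue u k < Ordinal.omega0 ^ k := by
  induction k with
  | zero => simp [coeffValue]
  | succ k ih =>
    calc coeffValue u (k + 1)
        < Ordinal.omega0 ^ k * (u k : Ordinal.{0}) + Ordinal.omega0 ^ k := by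
          simpa [coeffValue] using ih
      _ = Ordinal.omega0 ^ k * ((u k + 1 : ℕ) : Ordinal.{0}) := by
          push_cast; rw [mul_add, mul_one]
      _ ≤ Ordinal.omega0 ^ k * Ordinal.omega0 := by
          gcongr
          exact (Ordinal.natCast_lt_omega0 _).le
      _ = Ordinal.omega0 ^ (k + 1) := (pow_succ _ _).symm

theorem coeffValue_mono {u w : ℕ → ℕ} (h : u ≤ w) (k : ℕ) : coeffValue u k ≤ coeffValue w k := by
  induction k with
  | zero => simp [coeffValue]
  | succ k ih =>
    simp only [coeffValue]
    gcongr
    exact h k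

/-- The terms of `u` below exponent `k` together amount to less than one further copy of `ω ^ k`. -/
theorem coeffValue_succ_lt {u w : ℕ → ℕ} {k : ℕ} (h : u k < w k) :
    coeffValue u (k + 1) < coeffValue w (k + 1) := by
  calc coeffValue u (k + 1)
      < Ordinal.omega0 ^ k * (u k : Ordinal.{0}) + Ordinal.omega0 ^ k := by
        simpa [coeffValue] using coeffValue_lt u k
    _ = Ordinal.omega0 ^ k * ((u k + 1 : ℕ) : Ordinal.{0}) := by
        push_cast; rw [mul_add, mul_one]
    _ ≤ Ordinal.omega0 ^ k * (w k : Ordinal.{0}) := by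
        gcongr
        exact h
    _ ≤ coeffValue w (k + 1) := by simp [coeffValue]

theorem coeffLT_iff (u w : ℕ → ℕ) (k : ℕ) : CoeffLT u w k ↔ coeffValue u k < coeffValue w k := by
  induction k with
  | zero => simp [CoeffLT, coeffValue]
  | succ k ih =>
    rcases lt_trichotomy (u k) (w k) with h | h | h
    · simp [CoeffLT, h, coeffValue_succ_lt h]
    · simp [CoeffLT, coeffValue, h, ih]
    · simp [CoeffLT, h.not_gt, h.ne', (coeffValue_succ_lt h).le]

theorem coeffNormalForm_congr {u w : ℕ → ℕ} {k : ℕ} (h : ∀ i < k, u i = w i) :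
    coeffNormalForm u k = coeffNormalForm w k := by
  induction k with
  | zero => rfl
  | succ k ih =>
    simp only [coeffNormalForm, h k k.lt_succ_self, ih fun i hi => h i (hi.trans k.lt_succ_self)]

theorem coeffValue_congr {u w : ℕ → ℕ} {k : ℕ} (h : ∀ i < k, u i = w i) :
    coeffValue u k = coeffValue w k := by
  induction k with
  | zero => rfl
  | succ k ih =>
    simp only [coeffValue, h k k.lt_succ_self, ih fun i hi => h i (hi.trans k.lt_succ_self)]

theorem coeffNormalForm_eq_of_coeffValue_eq {u w : ℕ → ℕ} {k : ℕ}
    (h : coeffValue u k = coeffValue w k) : coeffNormalForm u k = coeffNormalForm w k := by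
  induction k with
  | zero => rfl
  | succ k ih =>
    have hk : u k = w k := by
      rcases lt_trichotomy (u k) (w k) with hlt | heq | hlt
      · exact absurd h (coeffValue_succ_lt hlt).ne
      · exact heq
      · exact absurd h (coeffValue_succ_lt hlt).ne'
    simp only [coeffValue, hk, add_right_inj] at h
    simp only [coeffNormalForm, hk, ih h]

theorem ordValue_cons (p : ℕ × ℕ) (l : List (ℕ × ℕ)) :
    ordValue (p :: l) = Ordinal.omega0 ^ p.1 * (p.2 : Ordinal.{0}) + ordValue l := by
  simp [ordValue]

theorem ordValue_coeffNormalForm (u : ℕ → ℕ) (k : ℕ) :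
    ordValue (coeffNormalForm u k) = coeffValue u k := by
  induction k with
  | zero => simp [ordValue, coeffNormalForm, coeffValue]
  | succ k ih =>
    by_cases h : u k = 0
    · simp [coeffNormalForm, coeffValue, h, ih]
    · simp [coeffNormalForm, coeffValue, h, ih, ordValue_cons]

theorem fst_lt_of_mem_coeffNormalForm {u : ℕ → ℕ} {k : ℕ} {p : ℕ × ℕ}
    (hp : p ∈ coeffNormalForm u k) : p.1 < k := by
  induction k with
  | zero => simp [coeffNormalForm] at hp
  | succ k ih =>
    by_cases h : u k = 0
    · simp only [coeffNormalForm, h, if_true] at hp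
      exact (ih hp).trans k.lt_succ_self
    · simp only [coeffNormalForm, h, if_false, List.mem_cons] at hp
      rcases hp with rfl | hp
      · exact k.lt_succ_self
      · exact (ih hp).trans k.lt_succ_self

theorem isNormalForm_cons {p : ℕ × ℕ} {l : List (ℕ × ℕ)} :
    IsNormalForm (p :: l) ↔ (∀ q ∈ l, q.1 < p.1) ∧ 0 < p.2 ∧ IsNormalForm l := by
  simp only [IsNormalForm, List.pairwise_cons, List.forall_mem_cons]
  tauto

theorem isNormalForm_coeffNormalForm (u : ℕ → ℕ) (k : ℕ) : IsNormalForm (coeffNormalForm u k) := by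
  induction k with
  | zero => simp [coeffNormalForm, IsNormalForm]
  | succ k ih =>
    by_cases h : u k = 0
    · simpa [coeffNormalForm, h] using ih
    · simp only [coeffNormalForm, h, if_false, isNormalForm_cons]
      exact ⟨fun q hq => fst_lt_of_mem_coeffNormalForm hq, Nat.pos_of_ne_zero h, ih⟩

theorem coeffNormalForm_mem (u : ℕ → ℕ) (k : ℕ) :
    coeffNormalForm u k ∈ normalFormsBelow (Ordinal.omega0 ^ k) :=
  ⟨isNormalForm_coeffNormalForm u k, (ordValue_coeffNormalForm u k).trans_lt (coeffValue_lt u k)⟩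

theorem exists_coeffNormalForm_eq {l : List (ℕ × ℕ)} {k : ℕ} (hl : IsNormalForm l)
    (hk : ∀ p ∈ l, p.1 < k) : ∃ u, coeffNormalForm u k = l := by
  induction k generalizing l with
  | zero =>
    cases l with
    | nil => exact ⟨0, rfl⟩
    | cons p l => exact absurd (hk p (by simp)) (Nat.not_lt_zero _)
  | succ k ih =>
    by_cases h : ∀ p ∈ l, p.1 < k
    · obtain ⟨u, rfl⟩ := ih hl h
      -- The inductive hypothesis controls `u` only below `k`, so its entry at `k` must be reset.
      refine ⟨Function.update u k 0, ?_⟩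
      simp only [coeffNormalForm, Function.update_self, if_true]
      exact coeffNormalForm_congr fun i hi => Function.update_of_ne hi.ne _ _
    · cases l with
      | nil => simp at h
      | cons p l =>
        obtain ⟨h1, h2, h3⟩ := isNormalForm_cons.1 hl
        have hp : p.1 = k := by
          refine (Nat.lt_succ_iff.1 (hk p (by simp))).eq_of_not_lt fun hlt => h fun q hq => ?_
          rcases List.mem_cons.1 hq with rfl | hq
          · exact hlt
          · exact (h1 q hq).trans hlt
        obtain ⟨u, rfl⟩ := ih h3 fun q hq => hp ▸ h1 q hq
        refine ⟨Function.update u k p.2, ?_⟩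
        simp only [coeffNormalForm, Function.update_self, h2.ne', if_false]
        rw [coeffNormalForm_congr (w := u) fun i hi => Function.update_of_ne hi.ne _ _, ← hp]

theorem fst_lt_of_ordValue_lt {l : List (ℕ × ℕ)} {k : ℕ} (hpos : ∀ p ∈ l, 0 < p.2)
    (hl : ordValue l < Ordinal.omega0 ^ k) : ∀ p ∈ l, p.1 < k := by
  induction l with
  | nil => simp
  | cons q l ih =>
    rw [ordValue_cons] at hl
    rw [List.forall_mem_cons] at hpos ⊢
    refine ⟨?_, ih hpos.2 (lt_of_le_of_lt (by simp) hl)⟩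
    by_contra! h
    refine hl.not_ge ?_
    calc Ordinal.omega0 ^ k ≤ Ordinal.omega0 ^ q.1 := pow_le_pow_right₀ Ordinal.one_lt_omega0.le h
      _ = Ordinal.omega0 ^ q.1 * ((1 : ℕ) : Ordinal.{0}) := by simp
      _ ≤ Ordinal.omega0 ^ q.1 * (q.2 : Ordinal.{0}) := by
        gcongr
        exact hpos.1
      _ ≤ _ := by simp

theorem mem_normalFormsBelow_omega0_pow {l : List (ℕ × ℕ)} {k : ℕ} :
    l ∈ normalFormsBelow (Ordinal.omega0 ^ k) ↔ ∃ u, coeffNormalForm u k = l := by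
  constructor
  · rintro ⟨h1, h2⟩
    exact exists_coeffNormalForm_eq h1 (fst_lt_of_ordValue_lt h1.2 h2)
  · rintro ⟨u, rfl⟩
    exact coeffNormalForm_mem u k

/-! ### Quotients of free commutative semigroups collapsing an ideal -/

/-- The number of occurrences of the generator `x_i` in a term. -/
def genCount {n : ℕ} : CSTerm n → ℕ → ℕ
  | .of j, i => if i = j then 1 else 0
  | .mul s t, i => genCount s i + genCount t i

theorem genCount_of {n : ℕ} (j : Fin n) : genCount (.of j) =
    fun i : ℕ => if i = (j : ℕ) then 1 else 0 := rfl

theorem genCount_mul {n : ℕ} (s t : CSTerm n) : genCount (s * t) = genCount s + genCount t := rfl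

theorem genCount_ne_zero {n : ℕ} (s : CSTerm n) : genCount s ≠ 0 := by
  induction s using FreeMagma.recOnMul with
  | ih1 j => exact fun h => by simpa [genCount_of] using congrFun h j
  | ih2 s t hs _ =>
    intro h
    rw [genCount_mul] at h
    exact hs (funext fun i => (Nat.add_eq_zero_iff.1 (congrFun h i)).1)

/-- Each factor would need an occurrence of `x_j`, which makes at least two. -/
theorem genCount_of_ne_mul {n : ℕ} (j : Fin n) (s t : CSTerm n) :
    genCount (.of j) ≠ genCount (s * t) := by
  intro h
  have key : ∀ r : CSTerm n, (∀ i ≠ (j : ℕ), genCount r i = 0) → 0 < genCount r j := by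
    intro r hr
    by_contra! h0
    refine genCount_ne_zero r (funext fun i => ?_)
    by_cases hi : i = j
    · subst hi; exact Nat.le_zero.1 h0
    · exact hr i hi
  have hst : ∀ i, genCount s i + genCount t i = if i = (j : ℕ) then 1 else 0 := fun i =>
    (congrFun h i).symm
  have hs := key s fun i hi => by have := hst i; rw [if_neg hi] at this; omega
  have ht := key t fun i hi => by have := hst i; rw [if_neg hi] at this; omega
  have := hst j
  rw [if_pos rfl] at this
  omega

theorem genCount_of_injective {n : ℕ} {j k : Fin n}
    (h : genCount (.of j) = genCount (.of k)) : j = k := by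
  have := congrFun h j
  rw [genCount_of, genCount_of] at this
  by_contra hne
  simp [Fin.val_inj, hne] at this

theorem exists_genCount_eq {n : ℕ} (u : ℕ → ℕ) (hu : ∃ i < n, u i ≠ 0) :
    ∃ s : CSTerm n, ∀ i < n, genCount s i = u i := by
  -- Induction on the total degree, written `m + 1` because there is no empty term.
  have key : ∀ (m : ℕ) (u : ℕ → ℕ), ∑ i ∈ Finset.range n, u i = m + 1 →
      ∃ s : CSTerm n, ∀ i < n, genCount s i = u i := by
    intro m
    induction m with
    | zero =>
      intro u hm
      have : ∃ j ∈ Finset.range n, u j ≠ 0 := by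
        by_contra! h
        rw [Finset.sum_eq_zero h] at hm
        omega
      obtain ⟨j, hj, hj0⟩ := this
      have hj' := Finset.mem_range.1 hj
      rw [← Finset.add_sum_erase _ _ hj] at hm
      have h0 : ∑ i ∈ (Finset.range n).erase j, u i = 0 := by omega
      rw [Finset.sum_eq_zero_iff] at h0
      refine ⟨.of ⟨j, hj'⟩, fun i hi => ?_⟩
      rw [genCount_of]
      by_cases hij : i = j
      · subst hij; simp; omega
      · simpa [hij] using (h0 i (by simp [hij, hi])).symm
    | succ m ih =>
      intro u hm
      have : ∃ j ∈ Finset.range n, u j ≠ 0 := by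
        by_contra! h
        rw [Finset.sum_eq_zero h] at hm
        omega
      obtain ⟨j, hj, hj0⟩ := this
      have hj' := Finset.mem_range.1 hj
      have hu : u = Function.update u j (u j - 1) + genCount (.of (⟨j, hj'⟩ : Fin n)) := by
        funext i
        by_cases hij : i = j
        · subst hij; simp [genCount_of]; omega
        · simp [genCount_of, hij]
      have hs : ∑ i ∈ Finset.range n, genCount (.of (⟨j, hj'⟩ : Fin n)) i = 1 := by
        simp [genCount_of, hj']
      obtain ⟨s, hs⟩ := ih (Function.update u j (u j - 1)) (by
        rw [hu] at hm
        simp only [Pi.add_apply, Finset.sum_add_distrib] at hm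
        omega)
      refine ⟨s * .of ⟨j, hj'⟩, fun i hi => ?_⟩
      rw [genCount_mul, Pi.add_apply, hs i hi]
      exact (congrFun hu i).symm
  obtain ⟨i, hi, h0⟩ := hu
  have : u i ≤ ∑ i ∈ Finset.range n, u i :=
    Finset.single_le_sum (fun _ _ => Nat.zero_le _) (Finset.mem_range.2 hi)
  exact key (∑ i ∈ Finset.range n, u i - 1) u (by omega)

/-- The presentation with index `a` collapses precisely the set `P` of terms, which is an ideal
invariant under associativity and commutativity. -/
structure Collapses {n : ℕ} (a : ℕ) (P : CSTerm n → Prop) : Prop where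
  mem_iff : ∀ s t, identityCode (s, t) ∈ W a ↔ P s ∧ P t
  mono : ∀ s t, genCount s ≤ genCount t → P s → P t

namespace Collapses

variable {n a b : ℕ} {P Q : CSTerm n → Prop}

theorem mul_right (hP : Collapses a P) {s : CSTerm n} (hs : P s) (t : CSTerm n) : P (s * t) :=
  hP.mono s _ (fun i => by simp [genCount_mul]) hs

theorem mul_left (hP : Collapses a P) {t : CSTerm n} (ht : P t) (s : CSTerm n) : P (s * t) :=
  hP.mono t _ (fun i => by simp [genCount_mul]) ht

/-- The relation on the right contains the defining identities and is itself a congruence, since `P`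
is an ideal depending only on the counts. -/
theorem eq_or (hP : Collapses a P) {s t : CSTerm n}
    (h : (s : CS n a) = t) : genCount s = genCount t ∨ P s ∧ P t := by
  have h' : ConGen.Rel (CSIdentity n a) s t := (Con.eq _).1 h
  clear h
  induction h' with
  | of s t h =>
    cases h with
    | rel _ _ h => exact Or.inr ((hP.mem_iff _ _).1 h)
    | assoc s t u => left; simp only [genCount_mul, add_assoc]
    | comm s t => left; simp only [genCount_mul, add_comm]
  | refl s => exact Or.inl rfl
  | symm _ ih => exact ih.imp Eq.symm And.symm
  | @trans s t u _ _ ih1 ih2 =>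
    rcases ih1 with h1 | h1 <;> rcases ih2 with h2 | h2
    · exact Or.inl (h1.trans h2)
    · exact Or.inr ⟨hP.mono _ _ h1.ge h2.1, h2.2⟩
    · exact Or.inr ⟨h1.1, hP.mono _ _ h2.le h1.2⟩
    · exact Or.inr ⟨h1.1, h2.2⟩
  | mul _ _ ih1 ih2 =>
    rcases ih1 with h1 | h1
    · rcases ih2 with h2 | h2
      · exact Or.inl (by rw [genCount_mul, genCount_mul, h1, h2])
      · exact Or.inr ⟨hP.mul_left h2.1 _, hP.mul_left h2.2 _⟩
    · exact Or.inr ⟨hP.mul_right h1.1 _, hP.mul_right h1.2 _⟩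

/-- This describes `P` by the multiplication alone, so isomorphisms respect it. Conversely, a zero
satisfies `s * s = s`, and since the counts of the two sides differ, only the collapse can identify
them. -/
theorem iff_isZero (hP : Collapses a P) (s : CSTerm n) :
    P s ↔ ∀ x : CS n a, (s : CS n a) * x = s := by
  constructor
  · intro hs x
    induction x using Con.induction_on with
    | H t =>
      rw [← Con.coe_mul]
      exact (Con.eq _).2 (ConGen.Rel.of _ _ (.rel _ _ ((hP.mem_iff _ _).2 ⟨hP.mul_right hs t, hs⟩)))
  · intro h
    have h' := h s
    rw [← Con.coe_mul] at h'
    rcases hP.eq_or h' with h1 | h1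
    · rw [genCount_mul] at h1
      exact absurd (add_eq_left.1 h1) (genCount_ne_zero s)
    · exact h1.2

/-! ### Isomorphisms between collapsed quotients -/

theorem iff_of_map_eq (hP : Collapses a P) (hQ : Collapses b Q) (φ : CS n a ≃* CS n b)
    {s t : CSTerm n} (h : φ (s : CS n a) = t) : P s ↔ Q t := by
  rw [hP.iff_isZero, hQ.iff_isZero, ← h]
  constructor
  · intro hs x
    obtain ⟨y, rfl⟩ := φ.surjective x
    rw [← map_mul, hs]
  · intro hs x
    exact φ.injective (by rw [map_mul, hs])

theorem of_ne_mul (hP : Collapses a P) {i : Fin n} (hi : ¬ P (.of i)) (x y : CS n a) :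
    ((FreeMagma.of i : CSTerm n) : CS n a) ≠ x * y := by
  induction x using Con.induction_on with
  | H s =>
    induction y using Con.induction_on with
    | H t =>
      rw [← Con.coe_mul]
      intro h
      rcases hP.eq_or h with h | h
      · exact genCount_of_ne_mul i s t h
      · exact hi h.1

theorem of_injective (hP : Collapses a P) {i j : Fin n} (hi : ¬ P (.of i))
    (h : ((FreeMagma.of i : CSTerm n) : CS n a) = (FreeMagma.of j : CSTerm n)) : i = j := by
  rcases hP.eq_or h with h | h
  · exact genCount_of_injective h
  · exact absurd h.1 hi

/-- If the image were represented by a product, `φ.symm` would factor a surviving generator. -/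
theorem exists_map_of (hP : Collapses a P) (hQ : Collapses b Q) (φ : CS n a ≃* CS n b)
    {i : Fin n} (hi : ¬ P (.of i)) :
    ∃ j : Fin n, ¬ Q (.of j) ∧
      φ ((FreeMagma.of i : CSTerm n) : CS n a) = (FreeMagma.of j : CSTerm n) := by
  obtain ⟨t, ht⟩ : ∃ t : CSTerm n, φ ((FreeMagma.of i : CSTerm n) : CS n a) = t := by
    generalize φ _ = y
    induction y using Con.induction_on with
    | H t => exact ⟨t, rfl⟩
  cases t with
  | of j => exact ⟨j, fun hj => hi ((iff_of_map_eq hP hQ φ ht).2 hj), ht⟩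
  | mul t u =>
    refine absurd ?_ (hP.of_ne_mul hi (φ.symm t) (φ.symm u))
    rw [← map_mul, MulEquiv.eq_symm_apply, ht]
    rfl

/-- Isomorphic collapsed quotients arise from each other by a permutation of the generators. -/
theorem exists_perm (hP : Collapses a P) (hQ : Collapses b Q) (φ : CS n a ≃* CS n b) :
    ∃ σ : Equiv.Perm (Fin n), ∀ s, P s ↔ Q (FreeMagma.map σ s) := by
  choose f hf hφ using fun i : {i : Fin n // ¬ P (.of i)} => exists_map_of hP hQ φ i.2
  let g : {i : Fin n // ¬ P (.of i)} → {i : Fin n // ¬ Q (.of i)} := fun i => ⟨f i, hf i⟩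
  have hg : Function.Bijective g := by
    constructor
    · intro i j hij
      have hij' : f i = f j := congrArg Subtype.val hij
      refine Subtype.ext (hP.of_injective i.2 (φ.injective ?_))
      rw [hφ, hφ, hij']
    · rintro ⟨j, hj⟩
      obtain ⟨i, hi, hji⟩ := exists_map_of hQ hP φ.symm hj
      refine ⟨⟨i, hi⟩, Subtype.ext (hQ.of_injective (hf _) ?_)⟩
      rw [← hφ, ← hji, MulEquiv.apply_symm_apply]
  classical
  let e := Equiv.ofBijective g hg
  -- `e.extendSubtype` matches the collapsed generators arbitrarily; there `φ` need not be compared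
  -- with it, as both sides are collapsed.
  have key : ∀ s : CSTerm n, φ (s : CS n a) = (FreeMagma.map e.extendSubtype s : CSTerm n) ∨
      P s ∧ Q (FreeMagma.map e.extendSubtype s) := by
    intro s
    induction s using FreeMagma.recOnMul with
    | ih1 i =>
      rw [FreeMagma.map_of]
      by_cases hi : P (.of i)
      · exact Or.inr ⟨hi, not_not.1 (e.extendSubtype_not_mem i (not_not.2 hi))⟩
      · left
        rw [e.extendSubtype_apply_of_mem i hi]
        exact hφ ⟨i, hi⟩
    | ih2 s t hs ht =>
      rw [map_mul]
      rcases hs with hs | hs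
      · rcases ht with ht | ht
        · left
          rw [Con.coe_mul, Con.coe_mul, map_mul, hs, ht]
        · exact Or.inr ⟨hP.mul_left ht.1 _, hQ.mul_left ht.2 _⟩
      · exact Or.inr ⟨hP.mul_right hs.1 _, hQ.mul_right hs.2 _⟩
  refine ⟨e.extendSubtype, fun s => ?_⟩
  rcases key s with h | h
  · exact iff_of_map_eq hP hQ φ h
  · exact iff_of_true h.1 h.2

/-- Comparable ideals with isomorphic collapsed quotients are equal. -/
theorem eq_of_le (hP : Collapses a P) (hQ : Collapses b Q) (φ : CS n a ≃* CS n b)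
    (h : ∀ s, Q s → P s) (s : CSTerm n) : P s ↔ Q s := by
  refine ⟨fun hs => ?_, h s⟩
  obtain ⟨σ, hσ⟩ := exists_perm hP hQ φ
  -- Each round applies `P s → Q (σ s)` and then `Q ⊆ P`. The exponent starts at `1` because `Q s`
  -- itself is the goal, reached when `σ ^ (k + 1) = 1`.
  have key : ∀ k : ℕ, Q (FreeMagma.map (σ ^ (k + 1) : Equiv.Perm (Fin n)) s) := by
    intro k
    induction k with
    | zero => simpa using (hσ s).1 hs
    | succ k ih =>
      have := (hσ _).1 (h _ ih)
      have hmap : ∀ r : CSTerm n, FreeMagma.map σ (FreeMagma.map (σ ^ (k + 1) : Equiv.Perm (Fin n)) r)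
          = FreeMagma.map (σ ^ (k + 1 + 1) : Equiv.Perm (Fin n)) r := by
        intro r
        induction r using FreeMagma.recOnMul with
        | ih1 i => simp [pow_succ' σ (k + 1)]
        | ih2 r t hr ht => rw [map_mul, map_mul, map_mul, hr, ht]
      rwa [hmap] at this
  have := key (orderOf σ - 1)
  rw [Nat.sub_add_cancel (orderOf_pos σ), pow_orderOf_eq_one] at this
  have hid : ∀ r : CSTerm n, FreeMagma.map (1 : Equiv.Perm (Fin n)) r = r := by
    intro r
    induction r using FreeMagma.recOnMul with
    | ih1 i => simp
    | ih2 r t hr ht => rw [map_mul, hr, ht]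
  rwa [hid] at this

theorem csIso (hP : Collapses a P) (hQ : Collapses b P) : CSIso n a b := by
  have hle : ∀ {c d : ℕ}, Collapses c P → Collapses d P → ∀ s t, CSIdentity n c s t →
      CSIdentity n d s t := by
    intro c d hc hd s t h
    cases h with
    | rel _ _ h => exact .rel _ _ ((hd.mem_iff _ _).2 ((hc.mem_iff _ _).1 h))
    | assoc s t u => exact .assoc s t u
    | comm s t => exact .comm s t
  have : conGen (CSIdentity n a) = conGen (CSIdentity n b) :=
    le_antisymm (Con.conGen_mono (hle hP hQ)) (Con.conGen_mono (hle hQ hP))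
  exact ⟨Con.congr (MulEquiv.refl _) this⟩

end Collapses

/-! ### Computability -/

/-- The s-m-n theorem for sets defined by unbounded search. -/
theorem exists_computable_index {R : ℕ → ℕ → ℕ → Prop}
    (hR : ComputablePred fun p : (ℕ × ℕ) × ℕ => R p.1.1 p.1.2 p.2) :
    ∃ f : ℕ → ℕ, Computable f ∧ ∀ e m, m ∈ W (f e) ↔ ∃ k, R e m k := by
  obtain ⟨g, hg, hgR⟩ := ComputablePred.computable_iff.1 hR
  have hgR' : ∀ e m k, R e m k ↔ g ((e, m), k) = true := fun e m k =>
    iff_of_eq (congrFun hgR ((e, m), k))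
  let search (p : ℕ × ℕ) : ℕ →. Bool := fun k => Part.some (g (p, k))
  have hsearch : Partrec fun p => Nat.rfind (search p) := Partrec.rfind hg.partrec
  -- One program searches on input `(e, m)`; currying it at `e` yields the index.
  obtain ⟨c, hc⟩ := Nat.Partrec.Code.exists_code.1
    (Partrec.nat_iff.1 (hsearch.comp Computable.unpair))
  refine ⟨fun e => Encodable.encode (Nat.Partrec.Code.curry c e),
    Computable.encode.comp
      (Nat.Partrec.Code.primrec₂_curry.to_comp.comp (Computable.const c) Computable.id), ?_⟩
  intro e m
  have hW : m ∈ W (Encodable.encode (Nat.Partrec.Code.curry c e)) ↔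
      (Nat.rfind (search (e, m))).Dom := by
    change (Nat.Partrec.Code.eval _ _).Dom ↔ _
    rw [Denumerable.ofNat_encode, Nat.Partrec.Code.eval_curry, hc]
    change (Nat.rfind (search (Nat.unpair (Nat.pair e m)))).Dom ↔ _
    rw [Nat.unpair_pair]
  rw [hW, Nat.rfind_dom']
  constructor
  · rintro ⟨k, hk, _⟩
    exact ⟨k, (hgR' e m k).2 (Part.mem_some_iff.1 hk).symm⟩
  · rintro ⟨k, hk⟩
    exact ⟨k, Part.mem_some_iff.2 ((hgR' e m k).1 hk).symm, fun _ => trivial⟩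

/-! ### Primitive recursive tests on codes -/

/-- The number of occurrences of `x_i` in the term over `n` generators with a given code. -/
def codeCount (n i m : ℕ) : ℕ :=
  -- The clause `n = 0` secures termination: code `0` would otherwise unpair to itself.
  if m < n ∨ n = 0 then if m = i then 1 else 0
  else codeCount n i (m - n).unpair.1 + codeCount n i (m - n).unpair.2
termination_by m
decreasing_by
  · have := Nat.unpair_left_le (m - n); omega
  · have := Nat.unpair_right_le (m - n); omega

theorem generators_pos {n : ℕ} (s : CSTerm n) : 0 < n := by
  induction s with
  | of j => exact j.pos
  | mul _ _ hs _ => exact hs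

theorem codeCount_termCode {n : ℕ} (s : CSTerm n) (i : ℕ) :
    codeCount n i (termCode s) = genCount s i := by
  induction s with
  | of j =>
    rw [codeCount, if_pos (Or.inl (by simp [termCode]))]
    simp only [termCode, genCount, eq_comm]
  | mul s t hs ht =>
    have hn := (generators_pos s).ne'
    rw [codeCount, if_neg (by simp [termCode, hn])]
    simp [termCode, genCount, hs, ht]

theorem primrec_codeCount (n i : ℕ) : Primrec (codeCount n i) := by
  -- Course-of-values recursion: `l` lists the earlier values, so its length is the current code.
  have hprev : Primrec₂ fun (_ : Unit) (l : List ℕ) =>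
      some (if l.length < n ∨ n = 0 then if l.length = i then 1 else 0
        else l.getD (l.length - n).unpair.1 0 + l.getD (l.length - n).unpair.2 0) := by
    have hlen : Primrec fun p : Unit × List ℕ => p.2.length :=
      Primrec.list_length.comp Primrec.snd
    have hsub : Primrec fun p : Unit × List ℕ => (p.2.length - n).unpair :=
      Primrec.unpair.comp (Primrec.nat_sub.comp hlen (Primrec.const n))
    refine Primrec.option_some.comp (Primrec.ite ?_ (Primrec.ite ?_ ?_ ?_) ?_)
    · exact (Primrec.nat_lt.comp hlen (Primrec.const n)).or
        (Primrec.eq.comp (Primrec.const n) (Primrec.const 0))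
    · exact Primrec.eq.comp hlen (Primrec.const i)
    · exact Primrec.const 1
    · exact Primrec.const 0
    · exact Primrec.nat_add.comp
        ((Primrec.list_getD 0).comp Primrec.snd (Primrec.fst.comp hsub))
        ((Primrec.list_getD 0).comp Primrec.snd (Primrec.snd.comp hsub))
  have : Primrec₂ fun (_ : Unit) (m : ℕ) => codeCount n i m := by
    refine Primrec.nat_strong_rec _ hprev fun _ m => ?_
    have h1 := Nat.unpair_left_le (m - n)
    have h2 := Nat.unpair_right_le (m - n)
    conv_rhs => rw [codeCount]
    simp only [List.length_map, List.length_range]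
    by_cases hm : m < n ∨ n = 0
    · simp [hm]
    · have h3 : (m - n).unpair.1 < m := by omega
      have h4 : (m - n).unpair.2 < m := by omega
      simp [hm, h3, h4]
  exact this.comp (Primrec.const ()) Primrec.id

theorem primrecPred_coeffLT {α : Type*} [Primcodable α] {u w : α → ℕ → ℕ}
    (hu : ∀ i, Primrec fun a => u a i) (hw : ∀ i, Primrec fun a => w a i) (k : ℕ) :
    PrimrecPred fun a => CoeffLT (u a) (w a) k := by
  induction k with
  | zero => exact (Primrec.eq.comp (Primrec.const 0) (Primrec.const 1)).of_eq (by simp [CoeffLT])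
  | succ k ih =>
    exact (Primrec.nat_lt.comp (hu k) (hw k)).or ((Primrec.eq.comp (hu k) (hw k)).and ih)

theorem primrec_coeffNormalForm {α : Type*} [Primcodable α] {u : α → ℕ → ℕ}
    (hu : ∀ i, Primrec fun a => u a i) (k : ℕ) :
    Primrec fun a => coeffNormalForm (u a) k := by
  induction k with
  | zero => exact Primrec.const []
  | succ k ih =>
    exact Primrec.ite (Primrec.eq.comp (hu k) (Primrec.const 0)) ih
      (Primrec.list_cons.comp (Primrec.pair (Primrec.const k) (hu k)) ih)

/-! ### The reduction -/

/-- A term is in the ideal given by `W e` if its value exceeds some ordinal with code in `W e`. -/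
def InIdeal {n : ℕ} (h : List (ℕ × ℕ) → ℕ) (e : ℕ) (s : CSTerm n) : Prop :=
  ∃ u : ℕ → ℕ, h (coeffNormalForm u n) ∈ W e ∧ coeffValue u n < coeffValue (genCount s) n

theorem exists_collapses (n : ℕ) {h : List (ℕ × ℕ) → ℕ} (hh : Computable h) :
    ∃ f : ℕ → ℕ, Computable f ∧ ∀ e, Collapses (n := n) (f e) (InIdeal h e) := by
  -- A search candidate `k` codes a list of coefficients, padded by zeros, and a step bound for the
  -- enumeration of `W e`.
  let seq (k : ℕ) : ℕ → ℕ := fun i => ((Denumerable.ofNat (List ℕ × ℕ) k).1).getD i 0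
  let R (e m k : ℕ) : Prop :=
    ((Nat.Partrec.Code.evaln (Denumerable.ofNat (List ℕ × ℕ) k).2
      (Denumerable.ofNat Nat.Partrec.Code e) (h (coeffNormalForm (seq k) n))).isSome = true) ∧
    (CoeffLT (seq k) (fun i => codeCount n i m.unpair.1) n ∧
      CoeffLT (seq k) (fun i => codeCount n i m.unpair.2) n)
  have hk : Primrec fun p : (ℕ × ℕ) × ℕ => Denumerable.ofNat (List ℕ × ℕ) p.2 :=
    (Primrec.ofNat _).comp Primrec.snd
  have hseq : ∀ i, Primrec fun p : (ℕ × ℕ) × ℕ => seq p.2 i := fun i =>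
    (Primrec.list_getD 0).comp (Primrec.fst.comp hk) (Primrec.const i)
  have hm : Primrec fun p : (ℕ × ℕ) × ℕ => p.1.2.unpair :=
    Primrec.unpair.comp (Primrec.snd.comp Primrec.fst)
  have hR : ComputablePred fun p : (ℕ × ℕ) × ℕ => R p.1.1 p.1.2 p.2 := by
    have h1 : Computable fun p : (ℕ × ℕ) × ℕ =>
        (Nat.Partrec.Code.evaln (Denumerable.ofNat (List ℕ × ℕ) p.2).2
          (Denumerable.ofNat Nat.Partrec.Code p.1.1)
          (h (coeffNormalForm (seq p.2) n))).isSome := by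
      refine Primrec.option_isSome.to_comp.comp
        (Nat.Partrec.Code.primrec_evaln.to_comp.comp (Computable.pair (Computable.pair ?_ ?_) ?_))
      · exact (Primrec.snd.comp hk).to_comp
      · exact ((Primrec.ofNat _).comp (Primrec.fst.comp Primrec.fst)).to_comp
      · exact hh.comp (primrec_coeffNormalForm hseq n).to_comp
    obtain ⟨_, h2⟩ := (primrecPred_coeffLT hseq
      (fun i => (primrec_codeCount n i).comp (Primrec.fst.comp hm)) n).and
      (primrecPred_coeffLT hseq
        (fun i => (primrec_codeCount n i).comp (Primrec.snd.comp hm)) n)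
    refine ComputablePred.computable_iff.2
      ⟨_, Primrec.and.to_comp.comp h1 h2.to_comp, funext fun p => propext ?_⟩
    simp [R]
  obtain ⟨f, hf, hfR⟩ := exists_computable_index hR
  refine ⟨f, hf, fun e => ⟨fun s t => ?_, ?_⟩⟩
  · rw [hfR]
    simp only [R, identityCode, Nat.unpair_pair, codeCount_termCode, coeffLT_iff]
    constructor
    · rintro ⟨k, h1, h2, h3⟩
      obtain ⟨x, hx⟩ := Option.isSome_iff_exists.1 h1
      have hW : h (coeffNormalForm (seq k) n) ∈ W e :=
        Part.dom_iff_mem.2 ⟨x, Nat.Partrec.Code.evaln_sound hx⟩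
      exact ⟨⟨_, hW, h2⟩, ⟨_, hW, h3⟩⟩
    · have key : ∀ u : ℕ → ℕ, h (coeffNormalForm u n) ∈ W e →
          coeffValue u n < coeffValue (genCount s) n → coeffValue u n < coeffValue (genCount t) n →
          ∃ k, R e (identityCode (s, t)) k := by
        intro u hu hs ht
        obtain ⟨x, hx⟩ := Part.dom_iff_mem.1 hu
        obtain ⟨j, hj⟩ := Nat.Partrec.Code.evaln_complete.1 hx
        refine ⟨Encodable.encode ((List.range n).map u, j), ?_⟩
        have hseq' : ∀ i < n, seq (Encodable.encode ((List.range n).map u, j)) i = u i := by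
          intro i hi
          simp [seq, hi]
        simp only [R, identityCode, Nat.unpair_pair, codeCount_termCode, coeffLT_iff,
          coeffNormalForm_congr hseq', coeffValue_congr hseq']
        refine ⟨?_, hs, ht⟩
        rw [Denumerable.ofNat_encode]
        exact Option.isSome_iff_exists.2 ⟨x, hj⟩
      simp only [R, identityCode, Nat.unpair_pair, codeCount_termCode, coeffLT_iff] at key
      rintro ⟨⟨u, hu, hus⟩, ⟨w, hw, hwt⟩⟩
      -- The search wants one ordinal below both terms; the smaller of the two witnesses serves.
      rcases le_total (coeffValue u n) (coeffValue w n) with hle | hle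
      · exact key u hu hus (hle.trans_lt hwt)
      · exact key w hw (hle.trans_lt hus) hwt
  · rintro s t hst ⟨u, hu, hus⟩
    exact ⟨u, hu, hus.trans_le (coeffValue_mono hst n)⟩

/-! ### Least elements and their ideals -/

theorem IsOrdinalEncoding.exists_eq {n : ℕ} {h : List (ℕ × ℕ) → ℕ}
    (hh : IsOrdinalEncoding (Ordinal.omega0 ^ n) h) (a : ℕ) :
    ∃ u, h (coeffNormalForm u n) = a := by
  obtain ⟨l, hl, rfl⟩ := hh.bijOn.surjOn (Set.mem_univ a)
  obtain ⟨u, rfl⟩ := mem_normalFormsBelow_omega0_pow.1 hl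
  exact ⟨u, rfl⟩

theorem IsOrdinalEncoding.encodedLE_iff {n : ℕ} {h : List (ℕ × ℕ) → ℕ}
    (hh : IsOrdinalEncoding (Ordinal.omega0 ^ n) h) (u w : ℕ → ℕ) :
    encodedLE (Ordinal.omega0 ^ n) h (h (coeffNormalForm u n)) (h (coeffNormalForm w n)) ↔
      coeffValue u n ≤ coeffValue w n := by
  rw [← ordValue_coeffNormalForm, ← ordValue_coeffNormalForm]
  constructor
  · rintro ⟨s, hs, t, ht, hsu, htw, hle⟩
    rwa [hh.bijOn.injOn hs (coeffNormalForm_mem u n) hsu,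
      hh.bijOn.injOn ht (coeffNormalForm_mem w n) htw] at hle
  · intro hle
    exact ⟨_, coeffNormalForm_mem u n, _, coeffNormalForm_mem w n, rfl, rfl, hle⟩

theorem IsOrdinalEncoding.exists_isLeastIn {n : ℕ} {h : List (ℕ × ℕ) → ℕ}
    (hh : IsOrdinalEncoding (Ordinal.omega0 ^ n) h) {S : Set ℕ} (hS : S.Nonempty) :
    ∃ u, IsLeastIn (encodedLE (Ordinal.omega0 ^ n) h) S (h (coeffNormalForm u n)) := by
  obtain ⟨a, ha⟩ := hS
  obtain ⟨v, rfl⟩ := hh.exists_eq a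
  obtain ⟨u, hu, hmin⟩ := (InvImage.wf (fun u : ℕ → ℕ => coeffValue u n)
    Ordinal.lt_wf).has_min {u | h (coeffNormalForm u n) ∈ S} ⟨v, ha⟩
  refine ⟨u, hu, fun b hb => ?_⟩
  obtain ⟨w, rfl⟩ := hh.exists_eq b
  exact (hh.encodedLE_iff u w).2 (not_lt.1 (hmin w hb))

theorem IsOrdinalEncoding.inIdeal_iff {n : ℕ} {h : List (ℕ × ℕ) → ℕ}
    (hh : IsOrdinalEncoding (Ordinal.omega0 ^ n) h) {e : ℕ} {u : ℕ → ℕ}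
    (hu : IsLeastIn (encodedLE (Ordinal.omega0 ^ n) h) (W e) (h (coeffNormalForm u n)))
    (s : CSTerm n) : InIdeal h e s ↔ coeffValue u n < coeffValue (genCount s) n := by
  constructor
  · rintro ⟨w, hw, hws⟩
    exact ((hh.encodedLE_iff u w).1 (hu.2 _ hw)).trans_lt hws
  · intro hs
    exact ⟨u, hu.1, hs⟩

theorem exists_coeffValue_lt {n : ℕ} (hn : 0 < n) (u : ℕ → ℕ) :
    ∃ s : CSTerm n, coeffValue u n < coeffValue (genCount s) n := by
  obtain ⟨k, rfl⟩ : ∃ k, n = k + 1 := ⟨n - 1, by omega⟩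
  -- Adding one everywhere raises the leading coefficient and ensures a nonzero exponent.
  obtain ⟨s, hs⟩ := exists_genCount_eq (n := k + 1) (fun i => u i + 1) ⟨0, hn, by simp⟩
  exact ⟨s, coeffValue_succ_lt (by rw [hs k k.lt_succ_self]; exact Nat.lt_succ_self _)⟩

theorem exists_coeffValue_eq {n : ℕ} {u : ℕ → ℕ} (hu : coeffValue u n ≠ 0) :
    ∃ s : CSTerm n, coeffValue (genCount s) n = coeffValue u n := by
  have : ∃ i < n, u i ≠ 0 := by
    by_contra! h
    refine hu ?_
    rw [coeffValue_congr (w := fun _ => 0) h]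
    clear h hu
    induction n with
    | zero => rfl
    | succ k ih => simp [coeffValue, ih]
  obtain ⟨s, hs⟩ := exists_genCount_eq u this
  exact ⟨s, coeffValue_congr hs⟩

/-- Were `w` larger, its ordinal would be nonzero, hence that of a term, and this term would
separate the two ideals. -/
theorem coeffValue_le_of_inIdeal_iff {n : ℕ} {u w : ℕ → ℕ}
    (h : ∀ s : CSTerm n, coeffValue u n < coeffValue (genCount s) n ↔
      coeffValue w n < coeffValue (genCount s) n) : coeffValue w n ≤ coeffValue u n := by
  by_contra! hlt
  obtain ⟨s, hs⟩ := exists_coeffValue_eq (ne_bot_of_gt hlt)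
  exact ((h s).1 (hs ▸ hlt)).ne hs.symm

theorem IsOrdinalEncoding.eMin_iff {n : ℕ} (hn : 0 < n) {h : List (ℕ × ℕ) → ℕ}
    (hh : IsOrdinalEncoding (Ordinal.omega0 ^ n) h) (e i : ℕ) :
    EMin (encodedLE (Ordinal.omega0 ^ n) h) e i ↔
      ∀ s : CSTerm n, InIdeal h e s ↔ InIdeal h i s := by
  have hempty : ∀ {e : ℕ}, W e = ∅ → ∀ s : CSTerm n, ¬ InIdeal h e s := by
    rintro e he s ⟨u, hu, _⟩
    simp [he] at hu
  rcases (W e).eq_empty_or_nonempty with he | he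
  · constructor
    · rintro (⟨m, hm, _⟩ | ⟨_, hi⟩) s
      · simp [he, IsLeastIn] at hm
      · exact iff_of_false (hempty he s) (hempty hi s)
    · intro hs
      refine Or.inr ⟨he, Set.eq_empty_iff_forall_notMem.2 fun a ha => ?_⟩
      obtain ⟨u, rfl⟩ := hh.exists_eq a
      obtain ⟨s, hus⟩ := exists_coeffValue_lt hn u
      exact hempty he s ((hs s).2 ⟨u, ha, hus⟩)
  · obtain ⟨u, hu⟩ := hh.exists_isLeastIn he
    constructor
    · rintro (⟨m, hme, hmi⟩ | ⟨he', _⟩) s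
      · obtain ⟨w, rfl⟩ := hh.exists_eq m
        rw [hh.inIdeal_iff hme, hh.inIdeal_iff hmi]
      · exact absurd he' he.ne_empty
    · intro hs
      have hi : (W i).Nonempty := by
        obtain ⟨s, hus⟩ := exists_coeffValue_lt hn u
        obtain ⟨w, hw, _⟩ := (hs s).1 ⟨u, hu.1, hus⟩
        exact ⟨_, hw⟩
      obtain ⟨w, hw⟩ := hh.exists_isLeastIn hi
      simp only [hh.inIdeal_iff hu, hh.inIdeal_iff hw] at hs
      have heq : coeffValue u n = coeffValue w n :=
        le_antisymm (coeffValue_le_of_inIdeal_iff fun s => (hs s).symm)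
          (coeffValue_le_of_inIdeal_iff hs)
      exact Or.inl ⟨_, hu, coeffNormalForm_eq_of_coeffValue_eq heq ▸ hw⟩

/-- Both ideals are preimages of upward closed sets of ordinals, and such sets form a chain. -/
theorem InIdeal.total {n : ℕ} {h : List (ℕ × ℕ) → ℕ} (e i : ℕ) :
    (∀ s : CSTerm n, InIdeal h e s → InIdeal h i s) ∨
      ∀ s : CSTerm n, InIdeal h i s → InIdeal h e s := by
  by_contra! hne
  obtain ⟨⟨s, ⟨u, hu, hus⟩, hs⟩, ⟨t, ⟨w, hw, hwt⟩, ht⟩⟩ := hne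
  rcases le_total (coeffValue u n) (coeffValue w n) with hle | hle
  · exact ht ⟨u, hu, hle.trans_lt hwt⟩
  · exact hs ⟨w, hw, hle.trans_lt hus⟩

theorem mainTheorem7 (n : ℕ) (hn : 2 ≤ n) (h : List (ℕ × ℕ) → ℕ)
    (hh : IsOrdinalEncoding (Ordinal.omega0 ^ n) h) :
    ComputablyReducible (EMin (encodedLE (Ordinal.omega0 ^ n) h)) (CSIso n) := by
  obtain ⟨f, hf, hcol⟩ := exists_collapses n hh.computable
  refine ⟨f, hf, fun e i => ?_⟩
  rw [hh.eMin_iff (by omega)]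
  constructor
  · intro hs
    have hei : InIdeal (n := n) h e = InIdeal h i := funext fun s => propext (hs s)
    exact (hcol e).csIso (hei ▸ hcol i)
  · rintro ⟨φ⟩
    rcases InIdeal.total (n := n) (h := h) e i with hle | hle
    · exact fun s => ((hcol i).eq_of_le (hcol e) φ.symm hle s).symm
    · exact (hcol e).eq_of_le (hcol i) φ hle
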